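/- For two positive real numbers $a\neq b$ and $r\in\mathbb{R}$, let $L_r(a,b)$ denote the generalized logarithmic mean $$L_r(a,b)=\left(\frac{b^r-a^r}{r(b-a)}\right)^{\frac1{r-1}}\quad (r\neq 0,1),$$ where the values at $r=0$ and $r=1$ are the corresponding limits $$L_0(a,b)=\frac{b-a}{\ln b-\ln a},\qquad L_1(a,b)=\frac1e\left(\frac{b^b}{a^a}\right)^{\frac1{b-a}}.$$ Then for every $r\in[0,+\infty)$ and all real numbers $b>a>0$, $$L_r(a,b)+L_{-r}(a,b)<a+b.$$ -/

import Mathlib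

/-- The generalized logarithmic mean (Stolarsky's one-parameter mean) `L_r(a, b)` of two positive
numbers `a`, `b`, for a real parameter `r`. Where the formula
`((b ^ r - a ^ r) / (r * (b - a))) ^ (1 / (r - 1))` is not defined (`r = 0`, `r = 1` or `a = b`),
the value is the corresponding limit. -/
noncomputable def genLogMean (r a b : ℝ) : ℝ :=
  if a = b then a
  else if r = 0 then (b - a) / (Real.log b - Real.log a)
  else if r = 1 then (1 / Real.exp 1) * (b ^ b / a ^ a) ^ (1 / (b - a))
  else ((b ^ r - a ^ r) / (r * (b - a))) ^ (1 / (r - 1))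

open Real Set Filter Topology

/-! Write `a = c * exp (-t)`, `b = c * exp t` with `c` the geometric mean, and let `s = log (sinh (r
t) / (r sinh t)) / (r ^ 2 - 1)`. The quotient is even in `r`, so the two means are `c * exp ((1 ± r)
s)`, and the claim becomes `exp s * cosh (r s) < cosh t`. Both sides tend to `1` as `t → 0`, so it
suffices to compare logarithmic derivatives: `s' (1 + r tanh (r s)) < tanh t`. Since `r s < t`, this
follows from `s' (1 + r tanh t) < tanh t`, which no longer involves `s`
(`exp_mul_cosh_mul_lt_cosh`). That bound reduces to `sub_one_mul_exp_mul_sub_sinh_pos` at `2 t`. For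
`r = 1` the limiting `s` is used; `r = 0` is just `sinh t < t cosh t`. -/

/-- A function on `(0, ∞)` with positive derivative and limit `0` at `0` is positive. -/
lemma pos_of_hasDerivAt_pos {f f' : ℝ → ℝ} (hf : ∀ x, 0 < x → HasDerivAt f (f' x) x)
    (h0 : Tendsto f (𝓝[>] 0) (𝓝 0)) (hf' : ∀ x, 0 < x → 0 < f' x) {x : ℝ} (hx : 0 < x) :
    0 < f x := by
  have hmono : StrictMonoOn f (Ioi 0) := by
    refine strictMonoOn_of_deriv_pos (convex_Ioi 0)
      (fun y hy => (hf y hy).continuousAt.continuousWithinAt) fun y hy => ?_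
    rw [interior_Ioi] at hy
    rw [(hf y hy).deriv]
    exact hf' y hy
  have h2 : 0 ≤ f (x / 2) := by
    refine le_of_tendsto h0 ?_
    filter_upwards [Ioo_mem_nhdsGT (half_pos hx)] with y hy
    exact (hmono hy.1 (half_pos hx) hy.2).le
  exact h2.trans_lt (hmono (half_pos hx) hx (half_lt_self hx))

/-- The version of `pos_of_hasDerivAt_pos` for functions that are differentiable at `0`. -/
lemma pos_of_hasDerivAt_pos_of_zero {f f' : ℝ → ℝ} (hf : ∀ x, HasDerivAt f (f' x) x)
    (h0 : f 0 = 0) (hf' : ∀ x, 0 < x → 0 < f' x) {x : ℝ} (hx : 0 < x) : 0 < f x := by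
  refine pos_of_hasDerivAt_pos (fun y _ => hf y) ?_ hf' hx
  have h := (hf 0).continuousAt.tendsto
  rw [h0] at h
  exact h.mono_left nhdsWithin_le_nhds

/-! ### Elementary hyperbolic inequalities -/

lemma sinh_lt_mul_cosh {x : ℝ} (hx : 0 < x) : sinh x < x * cosh x := by
  have h := pos_of_hasDerivAt_pos_of_zero (f := fun y => y * cosh y - sinh y)
    (f' := fun y => y * sinh y)
    (fun y => (((hasDerivAt_id y).mul (hasDerivAt_cosh y)).sub (hasDerivAt_sinh y)).congr_deriv
      (by simp)) (by simp) (fun y hy => mul_pos hy (sinh_pos_iff.2 hy)) hx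
  simpa using h

lemma hasDerivAt_sinh_mul (r x : ℝ) :
    HasDerivAt (fun y => sinh (r * y)) (r * cosh (r * x)) x :=
  (((hasDerivAt_id x).const_mul r).sinh).congr_deriv (by simp [mul_comm])

lemma hasDerivAt_exp_mul (r x : ℝ) :
    HasDerivAt (fun y => exp (r * y)) (r * exp (r * x)) x :=
  (((hasDerivAt_id x).const_mul r).exp).congr_deriv (by simp [mul_comm])

/-- The factor `r - 1` here and below treats `r < 1` and `r > 1` together, as the inequalities
reverse at `r = 1`. -/
lemma sub_one_mul_pos_of_strictMono {r x : ℝ} {g : ℝ → ℝ} (hg : StrictMonoOn g (Ici 0))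
    (hr : 0 < r) (hr1 : r ≠ 1) (hx : 0 < x) : 0 < (r - 1) * (g (r * x) - g x) := by
  rcases lt_or_gt_of_ne hr1 with h | h
  · exact mul_pos_of_neg_of_neg (sub_neg.2 h) (sub_neg.2
      (hg (mul_pos hr hx).le hx.le (by nlinarith)))
  · exact mul_pos (sub_pos.2 h) (sub_pos.2 (hg hx.le (mul_pos hr hx).le (by nlinarith)))

lemma sub_one_mul_sinh_mul_sub_pos {r x : ℝ} (hr : 0 < r) (hr1 : r ≠ 1) (hx : 0 < x) :
    0 < (r - 1) * (sinh (r * x) - r * sinh x) := by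
  refine pos_of_hasDerivAt_pos_of_zero (f := fun y => (r - 1) * (sinh (r * y) - r * sinh y))
    (f' := fun y => r * ((r - 1) * (cosh (r * y) - cosh y)))
    (fun y => (((hasDerivAt_sinh_mul r y).sub
      ((hasDerivAt_sinh y).const_mul r)).const_mul (r - 1)).congr_deriv (by ring))
    (by simp) (fun y hy => mul_pos hr ?_) hx
  exact sub_one_mul_pos_of_strictMono cosh_strictMonoOn hr hr1 hy

lemma sub_one_mul_exp_mul_sub_cosh_pos {r x : ℝ} (hr : 0 < r) (hr1 : r ≠ 1) (hx : 0 < x) :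
    0 < (r - 1) * (exp (r * x) - cosh x - r * sinh x) := by
  have h := pos_of_hasDerivAt_pos_of_zero
    -- The factor `exp y` turns the derivative into a comparison of `exp (r y)` with `exp y`.
    (f := fun y => (r - 1) * (exp (r * y) - cosh y - r * sinh y) * exp y)
    (f' := fun y => (r + 1) * exp y * ((r - 1) * (exp (r * y) - exp y)))
    (fun y => (((((hasDerivAt_exp_mul r y).sub (hasDerivAt_cosh y)).sub
      ((hasDerivAt_sinh y).const_mul r)).const_mul (r - 1)).mul (hasDerivAt_exp y)).congr_deriv
        (by
          have : exp y = cosh y + sinh y := (cosh_add_sinh y).symm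
          simp only [this, Pi.sub_apply]
          ring))
    (by simp) (fun y hy => mul_pos (by positivity)
      (sub_one_mul_pos_of_strictMono (exp_strictMono.strictMonoOn _) hr hr1 hy)) hx
  exact pos_of_mul_pos_left h (exp_pos x).le

lemma sub_one_mul_exp_mul_sub_sinh_pos {r x : ℝ} (hr : 0 < r) (hr1 : r ≠ 1) (hx : 0 < x) :
    0 < (r - 1) * (exp (r * x) - 1 - r * sinh x - r ^ 2 * (cosh x - 1)) := by
  refine pos_of_hasDerivAt_pos_of_zero
    (f := fun y => (r - 1) * (exp (r * y) - 1 - r * sinh y - r ^ 2 * (cosh y - 1)))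
    (f' := fun y => r * ((r - 1) * (exp (r * y) - cosh y - r * sinh y)))
    (fun y => (((((hasDerivAt_exp_mul r y).sub_const 1).sub
      ((hasDerivAt_sinh y).const_mul r)).sub
        (((hasDerivAt_cosh y).sub_const 1).const_mul (r ^ 2))).const_mul (r - 1)).congr_deriv
          (by ring))
    (by simp) (fun y hy => mul_pos hr (sub_one_mul_exp_mul_sub_cosh_pos hr hr1 hy)) hx

/-- This is the limit `r → 1` of `sub_one_mul_exp_mul_sub_sinh_pos` after division by `(r - 1) ^ 2`:
the bracket there vanishes at `r = 1`, and its `r`-derivative appears here. -/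
lemma sinh_add_two_mul_cosh_lt {x : ℝ} (hx : 0 < x) :
    sinh x + 2 * (cosh x - 1) < x * exp x := by
  have h := pos_of_hasDerivAt_pos_of_zero
    (f := fun y => y * exp y - sinh y - 2 * (cosh y - 1))
    (f' := fun y => y * exp y - sinh y)
    (fun y => ((((hasDerivAt_id y).mul (hasDerivAt_exp y)).sub (hasDerivAt_sinh y)).sub
      (((hasDerivAt_cosh y).sub_const 1).const_mul 2)).congr_deriv (by
        have : exp y = cosh y + sinh y := (cosh_add_sinh y).symm
        simp only [this, id]
        ring))
    (by simp) (fun y hy => by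
      have h1 := sinh_lt_mul_cosh hy
      have h2 := mul_pos hy (sinh_pos_iff.2 hy)
      rw [← cosh_add_sinh y]
      linarith) hx
  linarith

lemma tendsto_sinh_mul_div (r : ℝ) :
    Tendsto (fun t => sinh (r * t) / t) (𝓝[>] 0) (𝓝 r) := by
  have h := (hasDerivAt_iff_tendsto_slope.1 (hasDerivAt_sinh_mul r 0)).mono_left
    (nhdsWithin_mono (0 : ℝ) (fun y (hy : y ∈ Ioi 0) => (mem_Ioi.1 hy).ne'))
  simpa [slope_fun_def, div_eq_inv_mul] using h

/-! ### Reduction to a bound on `s'` -/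

/-- A bound on the logarithmic derivative `s'` integrates to a bound on `s`. -/
lemma exp_mul_cosh_mul_lt_cosh {r : ℝ} (hr : 0 < r) {s s' : ℝ → ℝ}
    (hs : ∀ t, 0 < t → HasDerivAt s (s' t) t) (h0 : Tendsto s (𝓝[>] 0) (𝓝 0))
    (hpos : ∀ t, 0 < t → 0 < s t)
    (hs' : ∀ t, 0 < t → s' t * (cosh t + r * sinh t) < sinh t) {t : ℝ} (ht : 0 < t) :
    exp (s t) * cosh (r * s t) < cosh t := by
  have hlt : ∀ t, 0 < t → r * s t < t := by
    intro t ht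
    have h := pos_of_hasDerivAt_pos (f := fun t => t - r * s t) (f' := fun t => 1 - r * s' t)
      (fun u hu => (hasDerivAt_id u).sub ((hs u hu).const_mul r))
      (by
        have h1 : Tendsto (fun t : ℝ => t) (𝓝[>] 0) (𝓝 0) := tendsto_id.mono_left nhdsWithin_le_nhds
        simpa using h1.sub (h0.const_mul r))
      (fun u hu => by
        have hS := sinh_pos_iff.2 hu
        have hC := cosh_pos u
        have h1 := hs' u hu
        -- If `r s' ≥ 1`, the bound on `s'` would give `cosh u + r sinh u < r sinh u`.
        by_contra! hcon
        have h2 := mul_le_mul_of_nonneg_right hcon (by positivity : 0 ≤ cosh u + r * sinh u)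
        have h3 := mul_lt_mul_of_pos_left h1 hr
        linarith) ht
    simpa using h
  have h := pos_of_hasDerivAt_pos (f := fun t => log (cosh t) - s t - log (cosh (r * s t)))
    (f' := fun t => sinh t / cosh t - s' t - sinh (r * s t) * (r * s' t) / cosh (r * s t))
    (fun u hu => (((hasDerivAt_cosh u).log (cosh_pos u).ne').sub (hs u hu)).sub
      ((((hs u hu).const_mul r).cosh).log (cosh_pos _).ne'))
    (by
      have h1 : Tendsto (fun t : ℝ => log (cosh t)) (𝓝[>] 0) (𝓝 0) := by
        have : ContinuousAt (fun t : ℝ => log (cosh t)) 0 :=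
          continuous_cosh.continuousAt.log (cosh_pos 0).ne'
        simpa using this.tendsto.mono_left nhdsWithin_le_nhds
      have h2 : Tendsto (fun t : ℝ => log (cosh (r * s t))) (𝓝[>] 0) (𝓝 0) := by
        have : ContinuousAt (fun t : ℝ => log (cosh t)) (r * 0) :=
          continuous_cosh.continuousAt.log (cosh_pos _).ne'
        simpa [Function.comp_def] using this.tendsto.comp (h0.const_mul r)
      simpa using (h1.sub h0).sub h2)
    (fun u hu => by
      have hS := sinh_pos_iff.2 hu
      have hC := cosh_pos u
      have hQ := sinh_pos_iff.2 (mul_pos hr (hpos u hu))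
      have hP := cosh_pos (r * s u)
      have h1 := hs' u hu
      have h2 : sinh (r * s u) * cosh u < sinh u * cosh (r * s u) := by
        have := sinh_pos_iff.2 (sub_pos.2 (hlt u hu))
        rw [sinh_sub] at this
        linarith
      have h3 : s' u * (cosh (r * s u) + r * sinh (r * s u)) * cosh u
          < sinh u * cosh (r * s u) := by
        have hK : 0 < cosh u + r * sinh u := by positivity
        have h4 := mul_lt_mul_of_pos_right h1
          (by positivity : 0 < (cosh (r * s u) + r * sinh (r * s u)) * cosh u)
        -- This is `tanh (r s) < tanh u` with denominators cleared.
        have h5 : (cosh (r * s u) + r * sinh (r * s u)) * cosh u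
            ≤ cosh (r * s u) * (cosh u + r * sinh u) := by
          have := mul_lt_mul_of_pos_left h2 hr
          linarith
        have h6 := mul_le_mul_of_nonneg_left h5 hS.le
        refine lt_of_mul_lt_mul_right ?_ hK.le
        linarith
      have h7 : sinh u / cosh u - s' u - sinh (r * s u) * (r * s' u) / cosh (r * s u)
          = (sinh u * cosh (r * s u) - s' u * (cosh (r * s u) + r * sinh (r * s u)) * cosh u)
            / (cosh u * cosh (r * s u)) := by
        field_simp
        ring
      rw [h7]
      exact div_pos (sub_pos.2 h3) (by positivity)) ht
  have h1 : log (exp (s t) * cosh (r * s t)) < log (cosh t) := by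
    rw [log_mul (exp_pos _).ne' (cosh_pos _).ne', log_exp]
    linarith
  exact (log_lt_log_iff (by positivity) (cosh_pos t)).1 h1

/-! ### The bound on `s'` for the means -/

lemma sinh_mul_div_pos {r t : ℝ} (hr : r ≠ 0) (ht : 0 < t) : 0 < sinh (r * t) / (r * sinh t) := by
  have hS := sinh_pos_iff.2 ht
  rcases lt_or_gt_of_ne hr with h | h
  · exact div_pos_of_neg_of_neg (sinh_neg_iff.2 (mul_neg_of_neg_of_pos h ht))
      (mul_neg_of_neg_of_pos h hS)
  · exact div_pos (sinh_pos_iff.2 (mul_pos h ht)) (mul_pos h hS)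

lemma exp_log_sinh_div_mul_cosh_lt {r t s : ℝ} (hr : 0 < r) (hr1 : r ≠ 1) (ht : 0 < t)
    (hs : s = log (sinh (r * t) / (r * sinh t)) / (r ^ 2 - 1)) :
    exp s * cosh (r * s) < cosh t := by
  have hr2 : r ^ 2 - 1 ≠ 0 := by
    have : r ^ 2 - 1 = (r - 1) * (r + 1) := by ring
    rw [this]
    exact mul_ne_zero (sub_ne_zero.2 hr1) (by positivity)
  subst hs
  refine exp_mul_cosh_mul_lt_cosh hr
    (s := fun t => log (sinh (r * t) / (r * sinh t)) / (r ^ 2 - 1))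
    (s' := fun t => (r * cosh (r * t) / sinh (r * t) - cosh t / sinh t) / (r ^ 2 - 1))
    ?_ ?_ ?_ ?_ ht
  · intro u hu
    have hS := sinh_pos_iff.2 hu
    have hA := sinh_pos_iff.2 (mul_pos hr hu)
    refine (((((hasDerivAt_sinh_mul r u).div ((hasDerivAt_sinh u).const_mul r)
      (by positivity)).log (sinh_mul_div_pos hr.ne' hu).ne').div_const (r ^ 2 - 1))).congr_deriv ?_
    simp only [Pi.div_apply]
    field_simp
  · have h1 : Tendsto (fun t => sinh (r * t) / (r * sinh t)) (𝓝[>] 0) (𝓝 1) := by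
      have h2 := (tendsto_sinh_mul_div r).div ((tendsto_sinh_mul_div 1).const_mul r)
        (by simpa using hr.ne')
      rw [mul_one, div_self hr.ne'] at h2
      refine h2.congr' ?_
      filter_upwards [self_mem_nhdsWithin] with y hy
      have hy : 0 < y := hy
      have hS := sinh_pos_iff.2 hy
      simp only [Pi.div_apply, one_mul]
      field_simp
    have h3 := ((continuousAt_log one_ne_zero).tendsto.comp h1).div_const (r ^ 2 - 1)
    simpa using h3
  · intro u hu
    have hS := mul_pos hr (sinh_pos_iff.2 hu)
    have h := sub_one_mul_sinh_mul_sub_pos hr hr1 hu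
    have hfac : r ^ 2 - 1 = (r - 1) * (r + 1) := by ring
    rcases lt_or_gt_of_ne hr1 with h1 | h1
    · refine div_pos_of_neg_of_neg (log_neg (sinh_mul_div_pos hr.ne' hu) ?_) (by nlinarith)
      rw [div_lt_one hS]
      linarith [neg_of_mul_pos_right h (by linarith)]
    · refine div_pos (log_pos ?_) (by nlinarith)
      rw [one_lt_div hS]
      linarith [pos_of_mul_pos_right h (by linarith)]
  · intro u hu
    have hS := sinh_pos_iff.2 hu
    have hC := cosh_pos u
    have hA := sinh_pos_iff.2 (mul_pos hr hu)
    have hB := cosh_pos (r * u)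
    have h := sub_one_mul_exp_mul_sub_sinh_pos hr hr1 (by positivity : 0 < 2 * u)
    have e1 : exp (r * (2 * u)) = (cosh (r * u) + sinh (r * u)) ^ 2 := by
      rw [cosh_add_sinh, ← exp_nat_mul]
      congr 1
      push_cast
      ring
    rw [e1, sinh_two_mul, cosh_two_mul] at h
    have e2 := cosh_sq u
    have e3 := cosh_sq (r * u)
    have e4 : 0 < cosh (r * u) - sinh (r * u) := by rw [cosh_sub_sinh]; exact exp_pos _
    generalize cosh (r * u) = B at *
    generalize sinh (r * u) = A at *
    generalize sinh u = S at *
    generalize cosh u = C at *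
    -- Multiplying by `B - A = exp (-r u)` and using `B ^ 2 - A ^ 2 = 1` makes the inequality linear
    -- in `A` and `B`.
    have key : 0 < (r - 1) * (A - (B - A) * (r * S * C + r ^ 2 * S ^ 2)) := by
      have h4 := mul_pos h e4
      have h5 : (r - 1) * ((B + A) ^ 2 - 1 - r * (2 * S * C) - r ^ 2 * (C ^ 2 + S ^ 2 - 1)) * (B - A)
          = 2 * ((r - 1) * (A - (B - A) * (r * S * C + r ^ 2 * S ^ 2))) := by
        rw [e2]
        linear_combination (r - 1) * (B + A) * e3
      linarith
    have h6 : S - (r * B / A - C / S) / (r ^ 2 - 1) * (C + r * S)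
        = (r - 1) * (A - (B - A) * (r * S * C + r ^ 2 * S ^ 2))
          * ((r + 1) / ((r ^ 2 - 1) ^ 2 * (A * S))) := by
      field_simp
      linear_combination ((r ^ 2 - 1) * A) * e2
    have h7 : 0 < (r ^ 2 - 1) ^ 2 := by positivity
    rw [← sub_pos, h6]
    exact mul_pos key (by positivity)

/-- The case `r = 1`, where `s` is the limit of the general expression. -/
lemma exp_mul_coth_mul_cosh_lt {t s : ℝ} (ht : 0 < t)
    (hs : s = (t * cosh t / sinh t - 1) / 2) :
    exp s * cosh s < cosh t := by
  subst hs
  have := exp_mul_cosh_mul_lt_cosh one_pos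
    (s := fun t => (t * cosh t / sinh t - 1) / 2)
    (s' := fun t => (cosh t / sinh t - t / sinh t ^ 2) / 2) ?_ ?_ ?_ ?_ ht
  · simpa using this
  · intro u hu
    have hS := sinh_pos_iff.2 hu
    refine (((((hasDerivAt_id u).mul (hasDerivAt_cosh u)).div (hasDerivAt_sinh u)
      hS.ne').sub_const 1).div_const 2).congr_deriv ?_
    simp only [Pi.mul_apply, id]
    field_simp
    linear_combination (-u) * cosh_sq u
  · have h1 := (tendsto_sinh_mul_div 1).inv₀ one_ne_zero
    have h2 : Tendsto cosh (𝓝[>] 0) (𝓝 1) := by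
      simpa using (continuous_cosh.tendsto 0).mono_left nhdsWithin_le_nhds
    have h3 := ((h2.mul h1).sub_const 1).div_const 2
    simp only [inv_one, mul_one, sub_self, zero_div] at h3
    refine h3.congr fun y => ?_
    simp only [one_mul, inv_div]
    ring
  · intro u hu
    have hS := sinh_pos_iff.2 hu
    refine half_pos (sub_pos.2 ?_)
    rw [one_lt_div hS]
    exact sinh_lt_mul_cosh hu
  · intro u hu
    have hS := sinh_pos_iff.2 hu
    have h := sinh_add_two_mul_cosh_lt (by positivity : 0 < 2 * u)
    have e1 : exp (2 * u) = (cosh u + sinh u) ^ 2 := by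
      rw [cosh_add_sinh, ← exp_nat_mul]
      norm_num
    rw [e1, sinh_two_mul, cosh_two_mul] at h
    have e2 := cosh_sq u
    have e4 : 0 < cosh u - sinh u := by rw [cosh_sub_sinh]; exact exp_pos _
    simp only [one_mul]
    generalize sinh u = S at *
    generalize cosh u = C at *
    have h4 := mul_pos (sub_pos.2 h) e4
    have h6 : S - (C / S - u / S ^ 2) / 2 * (C + S)
        = (2 * u * (C + S) ^ 2 - (2 * S * C + 2 * (C ^ 2 + S ^ 2 - 1))) * (C - S)
          / (4 * S ^ 2) := by
      field_simp
      linear_combination (4 * (C - S) - 4 * u * (C + S)) * e2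
    rw [← sub_pos, h6]
    positivity

/-! ### Passage to hyperbolic coordinates -/

/-- The generalized logarithmic mean in hyperbolic coordinates. -/
lemma genLogMean_mul_exp {r c t : ℝ} (hr : r ≠ 0) (hr1 : r ≠ 1) (hc : 0 < c) (ht : 0 < t) :
    genLogMean r (c * exp (-t)) (c * exp t)
      = c * exp (log (sinh (r * t) / (r * sinh t)) / (r - 1)) := by
  have hne : c * exp (-t) ≠ c * exp t := by
    intro h
    have := exp_injective (mul_left_cancel₀ hc.ne' h)
    linarith
  have hr1' := sub_ne_zero.2 hr1
  have hS := sinh_pos_iff.2 ht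
  have hpos := sinh_mul_div_pos hr ht
  rw [genLogMean, if_neg hne, if_neg hr, if_neg hr1]
  have e1 : ((c * exp t) ^ r - (c * exp (-t)) ^ r) / (r * (c * exp t - c * exp (-t)))
      = c ^ (r - 1) * (sinh (r * t) / (r * sinh t)) := by
    rw [mul_rpow hc.le (exp_pos _).le, mul_rpow hc.le (exp_pos _).le, ← exp_mul, ← exp_mul,
      rpow_sub_one hc.ne', sinh_eq (r * t)]
    rw [sinh_eq] at hS ⊢
    have : exp t - exp (-t) ≠ 0 := by linarith
    rw [show t * r = r * t by ring, show -t * r = -(r * t) by ring]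
    field_simp
  rw [e1, mul_rpow (rpow_nonneg hc.le _) hpos.le, ← rpow_mul hc.le, rpow_def_of_pos hpos,
    mul_one_div_cancel hr1', rpow_one, mul_one_div]

lemma genLogMean_one_mul_exp {c t : ℝ} (hc : 0 < c) (ht : 0 < t) :
    genLogMean 1 (c * exp (-t)) (c * exp t) = c * exp (t * cosh t / sinh t - 1) := by
  have hne : c * exp (-t) ≠ c * exp t := by
    intro h
    have := exp_injective (mul_left_cancel₀ hc.ne' h)
    linarith
  have hS := sinh_pos_iff.2 ht
  have ha : 0 < c * exp (-t) := by positivity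
  have hb : 0 < c * exp t := by positivity
  rw [genLogMean, if_neg hne, if_neg one_ne_zero, if_pos rfl]
  have e1 : (c * exp t) ^ (c * exp t) / (c * exp (-t)) ^ (c * exp (-t))
      = exp ((log c + t) * (c * exp t) - (log c - t) * (c * exp (-t))) := by
    rw [rpow_def_of_pos ha, rpow_def_of_pos hb, ← exp_sub, log_mul hc.ne' (exp_pos _).ne',
      log_mul hc.ne' (exp_pos _).ne', log_exp, log_exp, sub_eq_add_neg (log c) t]
  rw [e1, ← exp_mul, one_div, ← exp_neg, ← exp_add]
  have e2 (x : ℝ) : c * exp x = exp (log c + x) := by rw [exp_add, exp_log hc]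
  rw [e2 (t * cosh t / sinh t - 1)]
  congr 1
  rw [sinh_eq] at hS ⊢
  rw [cosh_eq]
  have h0 : exp t - exp (-t) ≠ 0 := by linarith
  have h1 : c * exp t - c * exp (-t) ≠ 0 := by
    rw [← mul_sub]
    exact mul_ne_zero hc.ne' h0
  generalize log c = l
  rw [← mul_sub] at *
  field_simp
  ring

lemma genLogMean_zero_mul_exp {c t : ℝ} (hc : 0 < c) (ht : 0 < t) :
    genLogMean 0 (c * exp (-t)) (c * exp t) = c * (sinh t / t) := by
  have hne : c * exp (-t) ≠ c * exp t := by
    intro h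
    have := exp_injective (mul_left_cancel₀ hc.ne' h)
    linarith
  rw [genLogMean, if_neg hne, if_pos rfl, log_mul hc.ne' (exp_pos _).ne',
    log_mul hc.ne' (exp_pos _).ne', log_exp, log_exp, sinh_eq]
  have : log c + t - (log c + -t) = 2 * t := by ring
  rw [this]
  field_simp

lemma exp_add_exp_eq_mul_cosh (r s : ℝ) :
    exp ((r + 1) * s) + exp ((1 - r) * s) = 2 * (exp s * cosh (r * s)) := by
  rw [cosh_eq, show (r + 1) * s = s + r * s by ring, show (1 - r) * s = s + -(r * s) by ring,
    exp_add, exp_add]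
  ring

lemma genLogMean_add_genLogMean_neg_lt_cosh {r c t : ℝ} (hr : 0 ≤ r) (hc : 0 < c) (ht : 0 < t) :
    genLogMean r (c * exp (-t)) (c * exp t) + genLogMean (-r) (c * exp (-t)) (c * exp t)
      < c * (2 * cosh t) := by
  rcases hr.eq_or_lt with rfl | hr
  · rw [neg_zero, genLogMean_zero_mul_exp hc ht, ← mul_add]
    have : sinh t / t < cosh t := by
      rw [div_lt_iff₀ ht, mul_comm]
      exact sinh_lt_mul_cosh ht
    exact mul_lt_mul_of_pos_left (by linarith) hc
  have hneg : sinh (-r * t) / (-r * sinh t) = sinh (r * t) / (r * sinh t) := by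
    rw [neg_mul, neg_mul, sinh_neg, neg_div_neg_eq]
  rw [genLogMean_mul_exp (r := -r) (by linarith) (by linarith) hc ht, hneg]
  by_cases hr1 : r = 1
  · subst hr1
    rw [genLogMean_one_mul_exp hc ht, ← mul_add]
    have h := exp_mul_coth_mul_cosh_lt ht rfl
    have h2 := exp_add_exp_eq_mul_cosh 1 ((t * cosh t / sinh t - 1) / 2)
    have hS := sinh_pos_iff.2 ht
    -- For `r = 1` the second mean is the geometric mean `c`.
    rw [one_mul, one_mul, div_self hS.ne', log_one, zero_div]
    rw [one_mul, sub_self, zero_mul, show (1 + 1 : ℝ) * ((t * cosh t / sinh t - 1) / 2)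
      = t * cosh t / sinh t - 1 by ring] at h2
    exact mul_lt_mul_of_pos_left (by linarith) hc
  · rw [genLogMean_mul_exp hr.ne' hr1 hc ht, ← mul_add]
    have h := exp_log_sinh_div_mul_cosh_lt hr hr1 ht rfl
    rw [← mul_lt_mul_iff_right₀ two_pos, ← exp_add_exp_eq_mul_cosh] at h
    refine mul_lt_mul_of_pos_left (lt_of_eq_of_lt ?_ h) hc
    have h1 := sub_ne_zero.2 hr1
    have h2 : r + 1 ≠ 0 := by positivity
    have h3 : r ^ 2 - 1 = (r - 1) * (r + 1) := by ring
    have h4 : -r - 1 = -(r + 1) := by ring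
    rw [h3, h4]
    congr 2
    · field_simp
    · field_simp
      ring

theorem theorem5p1 (r a b : ℝ) (hr : 0 ≤ r) (ha : 0 < a) (hab : a < b) :
    genLogMean r a b + genLogMean (-r) a b < a + b := by
  have hb := ha.trans hab
  have hl := log_lt_log ha hab
  have h := genLogMean_add_genLogMean_neg_lt_cosh hr (exp_pos ((log a + log b) / 2))
    (half_pos (sub_pos.2 hl))
  have ea : exp ((log a + log b) / 2) * exp (-((log b - log a) / 2)) = a := by
    rw [← exp_add, show (log a + log b) / 2 + -((log b - log a) / 2) = log a by ring, exp_log ha]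
  have eb : exp ((log a + log b) / 2) * exp ((log b - log a) / 2) = b := by
    rw [← exp_add, show (log a + log b) / 2 + (log b - log a) / 2 = log b by ring, exp_log hb]
  have ec : exp ((log a + log b) / 2) * (2 * cosh ((log b - log a) / 2)) = a + b := by
    rw [cosh_eq]
    linear_combination ea + eb
  rwa [ea, eb, ec] at h
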